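/- Let $G$ be a (finite-dimensional real) Lie group acting linearly and smoothly on $\mathbb{R}^n$, i.e. through a Lie group morphism $\rho : G \to \mathrm{GL}_n(\mathbb{R})$. For a smooth principal $G$-bundle $\pi : P \to M$ (with right action of $G$ on $P$) over an $n$-dimensional smooth manifold $M$, let $\mathrm{GL}(M) \to M$ be the bundle of linear frames, whose points over $x$ are the linear isomorphisms $u : \mathbb{R}^n \to T_xM$, with the right action of $\mathrm{GL}_n(\mathbb{R})$ by composition, and with its canonical soldering form $\theta_u(X) = u^{-1}(d\pi_{\mathrm{GL}(M)}(X))$. Let $P \times_G \mathbb{R}^n$ be the associated vector bundle, the quotient of $P \times \mathbb{R}^n$ by $(p, v) \sim (p\cdot g, \rho(g)^{-1} v)$. Consider the following three kinds of data. 1. Smooth bundle maps $\Phi : P \to \mathrm{GL}(M)$ over $\mathrm{id}_M$ which are $G$-equivariant: $\Phi(p \cdot g) = \Phi(p) \circ \rho(g)$. 2. Soldering forms: smooth $\mathbb{R}^n$-valued $1$-forms $\alpha$ on $P$ which are horizontal ($\alpha_p(X) = 0$ whenever $d\pi_p(X) = 0$), $G$-equivariant ($R_g^*\alpha = \rho(g)^{-1}\alpha$),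 and such that $\alpha_p : T_pP \to \mathbb{R}^n$ is onto for each $p \in P$. 3. Smooth vector bundle isomorphisms $\psi : TM \to P \times_G \mathbb{R}^n$ over $\mathrm{id}_M$. Then there are bijections between the data 1 and the data 2 and between the data 2 and the data 3, for all such bundles $P \to M$, such that for corresponding $\Phi$, $\alpha$, $\psi$ and all $p \in P$, $X \in T_pP$, $v \in \mathbb{R}^n$, $$\alpha = \Phi^*\theta, \qquad \Phi(p)(\alpha_p(X)) = d\pi_p(X), \qquad \psi(d\pi_p(X)) = [p, \alpha_p(X)], \qquad \psi(\Phi(p)(v)) = [p, v].$$ These bijections are natural: let $f : P' \to P$ be a smooth $G$-equivariant map of such principal bundles covering a local diffeomorphism $\varphi : M' \to M$, and let $(\Phi, \alpha, \psi)$ and $(\Phi', \alpha', \psi')$ be corresponding data on $P$ and $P'$. Then the following are equivalent: $d\varphi \circ \Phi'(p') = \Phi(f(p'))$ for all $p' \in P'$; $\alpha' = f^*\alpha$; and $\psi(d\varphi(w)) = [f(p'), v]$ whenever $\psi'(w) = [p', v]$. -/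

import Mathlib

open Bundle Set Topology MulOpposite
open scoped Manifold ContDiff

universe u v

noncomputable section

/-- The Euclidean space `ℝⁿ`. -/
abbrev Rn (n : ℕ) : Type := EuclideanSpace ℝ (Fin n)

/-- The space of endomorphisms of `ℝⁿ`. -/
abbrev EndRn (n : ℕ) : Type := Rn n →L[ℝ] Rn n

/-- The general linear group `GL_n(ℝ)`, a Lie group modelled on `End(ℝⁿ)`. -/
abbrev GLRn (n : ℕ) : Type := (EndRn n)ˣ

/-! ### The bundle of linear frames -/

section Frames

variable (n : ℕ) (M : Type u) [TopologicalSpace M] [ChartedSpace (Rn n) M] [IsManifold (𝓡 n) ∞ M]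

/-- The total space of the smooth vector bundle over `M` with fibre `Hom(ℝⁿ, T_x M)` at `x`. -/
abbrev FrameHomTotal : Type u :=
  TotalSpace (EndRn n) (fun x : M => Bundle.Trivial M (Rn n) x →L[ℝ] TangentSpace (𝓡 n) x)

theorem isOpen_isInvertible_frameHom :
    IsOpen {u : FrameHomTotal n M | u.2.IsInvertible} := by
  rw [isOpen_iff_mem_nhds]
  intro u hu
  let e := trivializationAt (EndRn n)
    (fun x : M => Bundle.Trivial M (Rn n) x →L[ℝ] TangentSpace (𝓡 n) x) u.1
  have hue : u ∈ e.source := by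
    rw [e.mem_source]; exact mem_baseSet_trivializationAt _ _ _
  have key : ∀ w ∈ e.source,
      w.2.IsInvertible ↔ (e w).2 ∈ range ((↑) : (Rn n ≃L[ℝ] Rn n) → EndRn n) := by
    intro w hw
    rw [e.mem_source] at hw
    have hw' : w.1 ∈ (trivializationAt (Rn n) (Bundle.Trivial M (Rn n)) u.1).baseSet ∩
      (trivializationAt (Rn n) (TangentSpace (𝓡 n) : M → Type _) u.1).baseSet := hw
    have h1 : (e w).2 = ContinuousLinearMap.inCoordinates (Rn n) (Bundle.Trivial M (Rn n)) (Rn n)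
        (TangentSpace (𝓡 n) : M → Type _) u.1 w.1 u.1 w.1 w.2 := rfl
    rw [h1, ContinuousLinearMap.inCoordinates_eq hw'.1 hw'.2]
    constructor
    · rintro ⟨a, ha⟩
      rw [← ha]
      exact ⟨((((trivializationAt (Rn n) (Bundle.Trivial M (Rn n)) u.1).continuousLinearEquivAt
        ℝ w.1 hw'.1).symm.trans a).trans ((trivializationAt (Rn n) (TangentSpace (𝓡 n) :
          M → Type _) u.1).continuousLinearEquivAt ℝ w.1 hw'.2)), rfl⟩
    · intro h
      have h2 : ContinuousLinearMap.IsInvertible _ := h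
      rw [ContinuousLinearMap.isInvertible_equiv_comp,
        ContinuousLinearMap.isInvertible_comp_equiv] at h2
      exact h2
  have ho : IsOpen (range ((↑) : (Rn n ≃L[ℝ] Rn n) → EndRn n)) := ContinuousLinearEquiv.isOpen
  have hc : ContinuousAt (fun w => (e w).2) u :=
    (continuous_snd.continuousAt).comp (e.toOpenPartialHomeomorph.continuousAt hue)
  have h3 := hc.preimage_mem_nhds (ho.mem_nhds ((key u hue).1 hu))
  filter_upwards [h3, e.open_source.mem_nhds hue] with w hw1 hw2
  exact (key w hw2).2 hw1

/-- The bundle `GL(M)` of linear frames: pairs of a point `x` of `M` and a linear isomorphism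
`ℝⁿ → T_x M`. It is a smooth manifold, being open in the total space of `Hom(ℝⁿ, TM)`. -/
def FrameBundle : Type u :=
  (⟨{u | u.2.IsInvertible}, isOpen_isInvertible_frameHom n M⟩ :
    TopologicalSpace.Opens (FrameHomTotal n M))

/-- The model with corners of the manifold `GL(M)`. -/
abbrev frameModel (n : ℕ) := (𝓡 n).prod 𝓘(ℝ, EndRn n)

instance : TopologicalSpace (FrameBundle n M) :=
  inferInstanceAs (TopologicalSpace (⟨{u | u.2.IsInvertible}, isOpen_isInvertible_frameHom n M⟩ :
    TopologicalSpace.Opens (FrameHomTotal n M)))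

instance : ChartedSpace (ModelProd (Rn n) (EndRn n)) (FrameBundle n M) :=
  inferInstanceAs (ChartedSpace (ModelProd (Rn n) (EndRn n))
    (⟨{u | u.2.IsInvertible}, isOpen_isInvertible_frameHom n M⟩ :
      TopologicalSpace.Opens (FrameHomTotal n M)))

instance : IsManifold (frameModel n) ∞ (FrameBundle n M) :=
  inferInstanceAs (IsManifold (frameModel n) ∞
    (⟨{u | u.2.IsInvertible}, isOpen_isInvertible_frameHom n M⟩ :
      TopologicalSpace.Opens (FrameHomTotal n M)))

variable {n M}

namespace FrameBundle

/-- The projection `GL(M) → M`. -/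
def proj (u : FrameBundle n M) : M := u.1.1

/-- The image of `v ∈ ℝⁿ` under the frame `u`, as a point of `TM`. -/
def apply (u : FrameBundle n M) (v : Rn n) : TangentBundle (𝓡 n) M := ⟨u.1.1, u.1.2 v⟩

/-- The right action of `GL_n(ℝ)` on `GL(M)` by composition of frames. -/
instance : MulAction (GLRn n)ᵐᵒᵖ (FrameBundle n M) where
  smul A u := ⟨⟨u.1.1, u.1.2 ∘L (A.unop : EndRn n)⟩, by
    have hu : u.1.2.IsInvertible := u.2
    exact hu.comp ⟨ContinuousLinearEquiv.unitsEquiv ℝ (Rn n) A.unop, rfl⟩⟩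
  one_smul u := rfl
  mul_smul A B u := rfl

theorem apply_smul (u : FrameBundle n M) (A : GLRn n) (v : Rn n) :
    (op A • u).apply v = u.apply ((A : EndRn n) v) := rfl

/-- The canonical soldering form of `GL(M)`: at the frame `u`, a tangent vector is projected to
`M` and expressed in the frame `u`. -/
def solderingForm (u : FrameBundle n M) : TangentSpace (frameModel n) u →L[ℝ] Rn n :=
  ContinuousLinearMap.inverse u.1.2 ∘L
    mfderiv (frameModel n) (𝓡 n) (proj : FrameBundle n M → M) u

end FrameBundle

end Frames

/-! ### Principal bundles -/

/-- A local trivialization of the principal bundle `pr : P → M`: an equivariant diffeomorphism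
`pr⁻¹(U) ≃ U × G` over an open set `U` of `M`. -/
structure IsPrincipalTrivialization {E_G H_G E_P H_P : Type*}
    [NormedAddCommGroup E_G] [NormedSpace ℝ E_G] [TopologicalSpace H_G]
    [NormedAddCommGroup E_P] [NormedSpace ℝ E_P] [TopologicalSpace H_P]
    (I_G : ModelWithCorners ℝ E_G H_G) (I_P : ModelWithCorners ℝ E_P H_P) (n : ℕ)
    {G : Type*} [TopologicalSpace G] [ChartedSpace H_G G] [Group G]
    {P : Type u} [TopologicalSpace P] [ChartedSpace H_P P] [MulAction Gᵐᵒᵖ P]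
    {M : Type v} [TopologicalSpace M] [ChartedSpace (Rn n) M]
    {pr : P → M} (e : Trivialization G pr) : Prop where
  contMDiffOn : ContMDiffOn I_P ((𝓡 n).prod I_G) ∞ e e.source
  contMDiffOn_symm :
    ContMDiffOn ((𝓡 n).prod I_G) I_P ∞ e.toOpenPartialHomeomorph.symm e.target
  equivariant : ∀ p ∈ e.source, ∀ g : G, (e (op g • p)).2 = (e p).2 * g

/-- A smooth principal `G`-bundle `proj : Total → Base` over an `n`-dimensional manifold, with a
right action of `G` on the total space. -/
structure PrincipalBundle {E_G H_G E_P H_P : Type*}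
    [NormedAddCommGroup E_G] [NormedSpace ℝ E_G] [TopologicalSpace H_G]
    [NormedAddCommGroup E_P] [NormedSpace ℝ E_P] [TopologicalSpace H_P]
    (I_G : ModelWithCorners ℝ E_G H_G) (I_P : ModelWithCorners ℝ E_P H_P)
    (G : Type*) [TopologicalSpace G] [ChartedSpace H_G G] [Group G] (n : ℕ) where
  Total : Type u
  [topTotal : TopologicalSpace Total]
  [chartedTotal : ChartedSpace H_P Total]
  [manifoldTotal : IsManifold I_P ∞ Total]
  Base : Type v
  [topBase : TopologicalSpace Base]
  [chartedBase : ChartedSpace (Rn n) Base]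
  [manifoldBase : IsManifold (𝓡 n) ∞ Base]
  [action : MulAction Gᵐᵒᵖ Total]
  proj : Total → Base
  contMDiff_proj : ContMDiff I_P (𝓡 n) ∞ proj
  contMDiff_action : ContMDiff (I_P.prod I_G) I_P ∞ (fun x : Total × G => op x.2 • x.1)
  proj_smul : ∀ (p : Total) (g : G), proj (op g • p) = proj p
  locally_trivial : ∀ x : Base, ∃ e : Trivialization G proj,
    IsPrincipalTrivialization I_G I_P n e ∧ x ∈ e.baseSet

namespace PrincipalBundle

attribute [instance] topTotal chartedTotal manifoldTotal topBase chartedBase manifoldBase action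

variable {E_G H_G E_P H_P : Type*}
  [NormedAddCommGroup E_G] [NormedSpace ℝ E_G] [TopologicalSpace H_G]
  [NormedAddCommGroup E_P] [NormedSpace ℝ E_P] [TopologicalSpace H_P]
  {I_G : ModelWithCorners ℝ E_G H_G} {I_P : ModelWithCorners ℝ E_P H_P}
  {G : Type*} [TopologicalSpace G] [ChartedSpace H_G G] [Group G] {n : ℕ}
  (B : PrincipalBundle.{u, v} I_G I_P G n)
  (ρ : ContMDiffMonoidMorphism I_G 𝓘(ℝ, EndRn n) ∞ G (GLRn n))

/-- The linear action of `G` on `ℝⁿ` given by a Lie group morphism `G → GL_n(ℝ)`. -/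
def linAct (ρ : ContMDiffMonoidMorphism I_G 𝓘(ℝ, EndRn n) ∞ G (GLRn n)) (g : G) : EndRn n :=
  ((ρ g : GLRn n) : EndRn n)

theorem linAct_one : linAct ρ (1 : G) = 1 := by simp [linAct]

theorem linAct_mul (g h : G) : linAct ρ (g * h) = linAct ρ g * linAct ρ h := by simp [linAct]

@[simp] theorem linAct_inv_apply (g : G) (v : Rn n) : linAct ρ g (linAct ρ g⁻¹ v) = v := by
  have h : linAct ρ g * linAct ρ g⁻¹ = 1 := by rw [← linAct_mul, mul_inv_cancel, linAct_one]
  exact congrArg (fun a : EndRn n => a v) h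

@[simp] theorem linAct_apply_inv (g : G) (v : Rn n) : linAct ρ g⁻¹ (linAct ρ g v) = v := by
  have h : linAct ρ g⁻¹ * linAct ρ g = 1 := by rw [← linAct_mul, inv_mul_cancel, linAct_one]
  exact congrArg (fun a : EndRn n => a v) h

theorem contMDiff_linAct : ContMDiff I_G 𝓘(ℝ, EndRn n) ∞ (linAct ρ) :=
  Units.contMDiff_val.comp ρ.contMDiff_toFun

/-! ### The action on the fibres is simply transitive -/

/-- The fibre of the principal bundle over `x`. -/
abbrev Fibre (x : B.Base) : Type u := {p : B.Total // B.proj p = x}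

variable {B} in
theorem free {p : B.Total} {g h : G} (H : op g • p = op h • p) : g = h := by
  obtain ⟨e, he, hx⟩ := B.locally_trivial (B.proj p)
  have hp : p ∈ e.source := by rwa [e.mem_source]
  have := congrArg (fun q => (e q).2) H
  simpa [he.equivariant p hp] using this

variable {B} in
theorem transitive {p q : B.Total} (H : B.proj q = B.proj p) : ∃ g : G, q = op g • p := by
  obtain ⟨e, he, hx⟩ := B.locally_trivial (B.proj p)
  have hp : p ∈ e.source := by rwa [e.mem_source]
  have hq : q ∈ e.source := by rwa [e.mem_source, H]
  refine ⟨(e p).2⁻¹ * (e q).2, ?_⟩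
  have hpg : op ((e p).2⁻¹ * (e q).2) • p ∈ e.source := by
    rwa [e.mem_source, B.proj_smul]
  apply e.toOpenPartialHomeomorph.injOn hq hpg
  refine Prod.ext ?_ ?_
  · change (e q).1 = (e _).1
    rw [e.coe_fst hq, e.coe_fst hpg, B.proj_smul, H]
  · change (e q).2 = (e _).2
    rw [he.equivariant p hp]; group

theorem fibre_nonempty (x : B.Base) : Nonempty (B.Fibre x) := by
  obtain ⟨e, he, hx⟩ := B.locally_trivial x
  exact ⟨⟨e.toOpenPartialHomeomorph.symm (x, 1), e.proj_symm_apply' hx⟩⟩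

/-! ### The associated vector bundle `P ×_G ℝⁿ` -/

/-- The equivalence relation `(p, v) ∼ (p · g, g⁻¹ · v)` on `P_x × ℝⁿ`. -/
def assocSetoid (x : B.Base) : Setoid (B.Fibre x × Rn n) where
  r a b := ∃ g : G, b.1.1 = op g • a.1.1 ∧ b.2 = linAct ρ g⁻¹ a.2
  iseqv :=
    { refl := fun a => ⟨1, by simp, by simp [linAct_one]⟩
      symm := by
        rintro ⟨p, v⟩ ⟨q, w⟩ ⟨g, h1, h2⟩
        refine ⟨g⁻¹, ?_, ?_⟩
        · simp only at h1 ⊢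
          rw [h1, smul_smul, ← op_mul, mul_inv_cancel, op_one, one_smul]
        · simp only at h2 ⊢
          rw [h2, inv_inv, linAct_inv_apply]
      trans := by
        rintro ⟨p, v⟩ ⟨q, w⟩ ⟨r, z⟩ ⟨g, h1, h2⟩ ⟨g', h3, h4⟩
        refine ⟨g * g', ?_, ?_⟩
        · simp only at h1 h3 ⊢
          rw [h3, h1, smul_smul, ← op_mul]
        · simp only at h2 h4 ⊢
          rw [h4, h2, mul_inv_rev, linAct_mul]; rfl }

/-- The fibre `(P_x × ℝⁿ) / G` of the associated bundle `P ×_G ℝⁿ`. -/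
def AssocFibre (x : B.Base) : Type u := Quotient (B.assocSetoid ρ x)

variable {B}

/-- The class `[p, v]` in the fibre of `P ×_G ℝⁿ` over `x`, for `p` in the fibre `P_x`. -/
def cls {x : B.Base} (p : B.Fibre x) (v : Rn n) : B.AssocFibre ρ x :=
  Quotient.mk (B.assocSetoid ρ x) (p, v)

theorem cls_eq_cls {x : B.Base} {p q : B.Fibre x} {v w : Rn n} :
    cls ρ p v = cls ρ q w ↔ ∃ g : G, q.1 = op g • p.1 ∧ w = linAct ρ g⁻¹ v :=
  Quotient.eq (r := B.assocSetoid ρ x)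

theorem cls_bijective {x : B.Base} (p : B.Fibre x) : Function.Bijective (cls ρ p) := by
  constructor
  · intro v w h
    obtain ⟨g, h1, h2⟩ := (cls_eq_cls ρ).1 h
    have : (1 : G) = g := free (p := p.1) (by simpa using h1)
    rw [h2, ← this]; simp [linAct_one]
  · intro z
    induction z using Quotient.inductionOn with
    | h a =>
      obtain ⟨q, v⟩ := a
      obtain ⟨g, hg⟩ := transitive (p := p.1) (q := q.1) (q.2.trans p.2.symm)
      exact ⟨linAct ρ g v, (cls_eq_cls ρ).2 ⟨g, hg, by simp⟩⟩

/-- The bijection `v ↦ [p, v]` from `ℝⁿ` to the fibre of `P ×_G ℝⁿ`. -/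
def clsEquiv {x : B.Base} (p : B.Fibre x) : Rn n ≃ B.AssocFibre ρ x :=
  Equiv.ofBijective (cls ρ p) (cls_bijective ρ p)

/-- An auxiliary point of the fibre over `x`; nothing below depends on its choice. -/
def pt (x : B.Base) : B.Fibre x := Classical.choice (B.fibre_nonempty x)

/-- The vector space structure on the fibres of `P ×_G ℝⁿ`, for which `v ↦ [p, v]` is linear
for every `p` (see `cls_add`, `cls_smul`). -/
instance (x : B.Base) : AddCommGroup (B.AssocFibre ρ x) := (clsEquiv ρ (pt x)).symm.addCommGroup

instance (x : B.Base) : Module ℝ (B.AssocFibre ρ x) := (clsEquiv ρ (pt x)).symm.module ℝ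

/-- The topology on the fibres of `P ×_G ℝⁿ`, transported from `ℝⁿ`. -/
instance (x : B.Base) : TopologicalSpace (B.AssocFibre ρ x) :=
  TopologicalSpace.induced (clsEquiv ρ (pt x)).symm inferInstance

/-- The coordinate on a fibre of `P ×_G ℝⁿ` given by the auxiliary point. -/
def ptCoord (x : B.Base) : B.AssocFibre ρ x ≃ₗ[ℝ] Rn n := (clsEquiv ρ (pt x)).symm.linearEquiv ℝ

theorem ptCoord_cls {x : B.Base} {p : B.Fibre x} {g : G} (hg : p.1 = op g • (pt x).1) (v : Rn n) :
    ptCoord ρ x (cls ρ p v) = linAct ρ g v := by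
  change (clsEquiv ρ (pt x)).symm (cls ρ p v) = _
  rw [Equiv.symm_apply_eq]
  exact ((cls_eq_cls ρ).2 ⟨g, hg, by simp⟩).symm

theorem cls_add {x : B.Base} (p : B.Fibre x) (v w : Rn n) :
    cls ρ p (v + w) = cls ρ p v + cls ρ p w := by
  obtain ⟨g, hg⟩ := transitive (p := (pt x).1) (q := p.1) (p.2.trans (pt x).2.symm)
  apply (ptCoord ρ x).injective
  rw [map_add, ptCoord_cls ρ hg, ptCoord_cls ρ hg, ptCoord_cls ρ hg, map_add]

theorem cls_smul {x : B.Base} (p : B.Fibre x) (c : ℝ) (v : Rn n) :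
    cls ρ p (c • v) = c • cls ρ p v := by
  obtain ⟨g, hg⟩ := transitive (p := (pt x).1) (q := p.1) (p.2.trans (pt x).2.symm)
  apply (ptCoord ρ x).injective
  rw [map_smul, ptCoord_cls ρ hg, ptCoord_cls ρ hg, map_smul]

/-- The fibre coordinate `[p, v] ↦ (e p).2 · v` of `P ×_G ℝⁿ` given by a local trivialization `e`
of the principal bundle. -/
def trivCoord {e : Trivialization G B.proj} (he : IsPrincipalTrivialization I_G I_P n e)
    {x : B.Base} (hx : x ∈ e.baseSet) : B.AssocFibre ρ x → Rn n :=
  Quotient.lift (fun a : B.Fibre x × Rn n => linAct ρ (e a.1.1).2 a.2) (by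
    rintro ⟨p, v⟩ ⟨q, w⟩ ⟨g, h1, h2⟩
    have hp : p.1 ∈ e.source := by rw [e.mem_source, p.2]; exact hx
    simp only at h1 h2 ⊢
    rw [h1, h2, he.equivariant p.1 hp, linAct_mul]
    simp)

theorem trivCoord_cls {e : Trivialization G B.proj} (he : IsPrincipalTrivialization I_G I_P n e)
    {x : B.Base} (hx : x ∈ e.baseSet) (p : B.Fibre x) (v : Rn n) :
    trivCoord ρ he hx (cls ρ p v) = linAct ρ (e p.1).2 v := rfl

/-- The local section `x ↦ e⁻¹(x, 1)` given by a local trivialization. -/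
def sect (e : Trivialization G B.proj) {x : B.Base} (hx : x ∈ e.baseSet) : B.Fibre x :=
  ⟨e.toOpenPartialHomeomorph.symm (x, 1), e.proj_symm_apply' hx⟩

theorem trivCoord_sect {e : Trivialization G B.proj} (he : IsPrincipalTrivialization I_G I_P n e)
    {x : B.Base} (hx : x ∈ e.baseSet) (v : Rn n) :
    trivCoord ρ he hx (cls ρ (sect e hx) v) = v := by
  rw [trivCoord_cls]
  have : (e (sect e hx).1).2 = 1 := congrArg Prod.snd (e.apply_symm_apply' (x := (1 : G)) hx)
  rw [this, linAct_one]; rfl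

theorem cls_sect_trivCoord {e : Trivialization G B.proj}
    (he : IsPrincipalTrivialization I_G I_P n e) {x : B.Base} (hx : x ∈ e.baseSet)
    (z : B.AssocFibre ρ x) : cls ρ (sect e hx) (trivCoord ρ he hx z) = z := by
  obtain ⟨v, rfl⟩ := (cls_bijective ρ (sect e hx)).2 z
  rw [trivCoord_sect]

open Classical in
/-- `trivCoord`, extended by `0` outside the domain of `e`. -/
def trivFun {e : Trivialization G B.proj} (he : IsPrincipalTrivialization I_G I_P n e)
    (x : B.Base) (z : B.AssocFibre ρ x) : Rn n :=
  if hx : x ∈ e.baseSet then trivCoord ρ he hx z else 0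

open Classical in
/-- The inverse of `trivCoord`, extended by `0` outside the domain of `e`. -/
def trivInv (e : Trivialization G B.proj) (x : B.Base) (v : Rn n) : B.AssocFibre ρ x :=
  if hx : x ∈ e.baseSet then cls ρ (sect e hx) v else 0

theorem trivFun_of_mem {e : Trivialization G B.proj} (he : IsPrincipalTrivialization I_G I_P n e)
    {x : B.Base} (hx : x ∈ e.baseSet) (z : B.AssocFibre ρ x) :
    trivFun ρ he x z = trivCoord ρ he hx z := dif_pos hx

theorem trivInv_of_mem {e : Trivialization G B.proj} {x : B.Base} (hx : x ∈ e.baseSet)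
    (v : Rn n) : trivInv ρ e x v = cls ρ (sect e hx) v := dif_pos hx

/-- The local trivialization of `P ×_G ℝⁿ` induced by a local trivialization `e` of the principal
bundle, sending `[p, v]` to `(π p, (e p).2 · v)`. -/
def assocPretriv {e : Trivialization G B.proj} (he : IsPrincipalTrivialization I_G I_P n e) :
    Pretrivialization (Rn n) (TotalSpace.proj : TotalSpace (Rn n) (B.AssocFibre ρ) → B.Base) where
  toFun z := (z.1, trivFun ρ he z.1 z.2)
  invFun y := ⟨y.1, trivInv ρ e y.1 y.2⟩
  source := TotalSpace.proj ⁻¹' e.baseSet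
  target := e.baseSet ×ˢ univ
  map_source' z hz := ⟨hz, mem_univ _⟩
  map_target' y hy := hy.1
  left_inv' := by
    rintro ⟨x, z⟩ hx
    have hx' : x ∈ e.baseSet := hx
    have h : trivInv ρ e x (trivFun ρ he x z) = z := by
      rw [trivFun_of_mem ρ he hx', trivInv_of_mem ρ hx', cls_sect_trivCoord]
    exact congrArg (TotalSpace.mk x) h
  right_inv' := by
    rintro ⟨x, v⟩ hx
    have hx' : x ∈ e.baseSet := hx.1
    have h : trivFun ρ he x (trivInv ρ e x v) = v := by
      rw [trivInv_of_mem ρ hx', trivFun_of_mem ρ he hx', trivCoord_sect]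
    exact congrArg (Prod.mk x) h
  open_target := e.open_baseSet.prod isOpen_univ
  baseSet := e.baseSet
  open_baseSet := e.open_baseSet
  source_eq := rfl
  target_eq := rfl
  proj_toFun _ _ := rfl

theorem assocPretriv_apply {e : Trivialization G B.proj}
    (he : IsPrincipalTrivialization I_G I_P n e) {x : B.Base} (hx : x ∈ e.baseSet)
    (z : B.AssocFibre ρ x) : assocPretriv ρ he ⟨x, z⟩ = (x, trivCoord ρ he hx z) := by
  exact congrArg (Prod.mk x) (trivFun_of_mem ρ he hx z)

theorem assocPretriv_symm {e : Trivialization G B.proj}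
    (he : IsPrincipalTrivialization I_G I_P n e) {x : B.Base} (hx : x ∈ e.baseSet)
    (v : Rn n) : (assocPretriv ρ he).symm x v = cls ρ (sect e hx) v := by
  have hx' : x ∈ (assocPretriv ρ he).baseSet := hx
  have h : assocPretriv ρ he ⟨x, cls ρ (sect e hx) v⟩ = (x, v) := by
    rw [assocPretriv_apply ρ he hx, trivCoord_sect]
  have h2 := (assocPretriv ρ he).symm_apply_apply_mk hx' (cls ρ (sect e hx) v)
  rw [h] at h2
  exact h2

theorem trivCoord_eq_ptCoord {e : Trivialization G B.proj}
    (he : IsPrincipalTrivialization I_G I_P n e) {x : B.Base} (hx : x ∈ e.baseSet)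
    (z : B.AssocFibre ρ x) :
    trivCoord ρ he hx z = linAct ρ (e (pt x).1).2 (ptCoord ρ x z) := by
  obtain ⟨v, rfl⟩ := (cls_bijective ρ (pt x)).2 z
  rw [trivCoord_cls, ptCoord_cls ρ (g := 1) (by simp), linAct_one]; rfl

/-- The transition functions of `P ×_G ℝⁿ`. -/
def assocCoordChange (e e' : Trivialization G B.proj) (x : B.Base) : EndRn n :=
  linAct ρ (e' (e.toOpenPartialHomeomorph.symm (x, 1))).2

theorem contMDiffOn_assocCoordChange {e e' : Trivialization G B.proj}
    (he : IsPrincipalTrivialization I_G I_P n e) (he' : IsPrincipalTrivialization I_G I_P n e') :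
    ContMDiffOn (𝓡 n) 𝓘(ℝ, EndRn n) ∞ (assocCoordChange ρ e e') (e.baseSet ∩ e'.baseSet) := by
  have h1 : ContMDiffOn (𝓡 n) I_P ∞
      (fun x : B.Base => e.toOpenPartialHomeomorph.symm (x, (1 : G))) (e.baseSet ∩ e'.baseSet) := by
    refine he.contMDiffOn_symm.comp (contMDiff_id.prodMk contMDiff_const).contMDiffOn ?_
    intro x hx
    rw [mem_preimage, e.mem_target]; exact hx.1
  have h2 : ContMDiffOn (𝓡 n) ((𝓡 n).prod I_G) ∞
      (fun x : B.Base => e' (e.toOpenPartialHomeomorph.symm (x, (1 : G))))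
      (e.baseSet ∩ e'.baseSet) := by
    refine he'.contMDiffOn.comp h1 ?_
    intro x hx
    rw [mem_preimage, e'.mem_source, e.proj_symm_apply' hx.1]; exact hx.2
  exact ((contMDiff_linAct ρ).comp contMDiff_snd).comp_contMDiffOn h2

theorem assocCoordChange_apply {e e' : Trivialization G B.proj}
    (he : IsPrincipalTrivialization I_G I_P n e) (he' : IsPrincipalTrivialization I_G I_P n e')
    {x : B.Base} (hx : x ∈ e.baseSet ∩ e'.baseSet) (v : Rn n) :
    assocCoordChange ρ e e' x v = (assocPretriv ρ he' ⟨x, (assocPretriv ρ he).symm x v⟩).2 := by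
  rw [assocPretriv_symm ρ he hx.1, assocPretriv_apply ρ he' hx.2, trivCoord_cls]; rfl

/-- A principal local trivialization around `x`. -/
def trivAt (x : B.Base) : Trivialization G B.proj := Classical.choose (B.locally_trivial x)

theorem trivAt_spec (x : B.Base) : IsPrincipalTrivialization I_G I_P n (trivAt x) :=
  (Classical.choose_spec (B.locally_trivial x)).1

theorem mem_trivAt (x : B.Base) : x ∈ (trivAt x).baseSet :=
  (Classical.choose_spec (B.locally_trivial x)).2

variable (B)

/-- The smooth vector bundle atlas of `P ×_G ℝⁿ` induced by all local trivializations of `P`. -/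
def assocPrebundle : VectorPrebundle ℝ (Rn n) (B.AssocFibre ρ) where
  pretrivializationAtlas :=
    {t | ∃ (e : Trivialization G B.proj) (he : IsPrincipalTrivialization I_G I_P n e),
      t = assocPretriv ρ he}
  pretrivialization_linear' := by
    rintro _ ⟨e, he, rfl⟩
    refine ⟨fun x hx => ?_⟩
    have hx' : x ∈ e.baseSet := hx
    constructor <;> intros <;>
      simp only [assocPretriv_apply ρ he hx', trivCoord_eq_ptCoord, map_add, map_smul]
  pretrivializationAt x := assocPretriv ρ (trivAt_spec x)
  mem_base_pretrivializationAt x := mem_trivAt x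
  pretrivialization_mem_atlas x := ⟨_, trivAt_spec x, rfl⟩
  exists_coordChange := by
    rintro _ ⟨e, he, rfl⟩ _ ⟨e', he', rfl⟩
    exact ⟨assocCoordChange ρ e e', (contMDiffOn_assocCoordChange ρ he he').continuousOn,
      fun x hx v => assocCoordChange_apply ρ he he' hx v⟩
  totalSpaceMk_isInducing := by
    intro x
    let φ : Rn n ≃L[ℝ] Rn n :=
      ContinuousLinearEquiv.unitsEquiv ℝ (Rn n) (ρ ((trivAt x) (pt x).1).2)
    have h1 : IsInducing (ptCoord ρ x) := ⟨rfl⟩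
    have h2 : IsInducing (fun z : B.AssocFibre ρ x => (x, φ (ptCoord ρ x z))) :=
      isInducing_const_prod.mpr (φ.toHomeomorph.isInducing.comp h1)
    convert h2 using 1
    funext z
    change assocPretriv ρ (trivAt_spec x) ⟨x, z⟩ = _
    rw [assocPretriv_apply ρ (trivAt_spec x) (mem_trivAt x), trivCoord_eq_ptCoord]
    rfl

instance : TopologicalSpace (TotalSpace (Rn n) (B.AssocFibre ρ)) :=
  (B.assocPrebundle ρ).totalSpaceTopology

/-- The fibre bundle `P ×_G ℝⁿ`. -/
instance : FiberBundle (Rn n) (B.AssocFibre ρ) := (B.assocPrebundle ρ).toFiberBundle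

instance : VectorBundle ℝ (Rn n) (B.AssocFibre ρ) := (B.assocPrebundle ρ).toVectorBundle

instance : (B.assocPrebundle ρ).IsContMDiff (𝓡 n) ∞ where
  exists_contMDiffCoordChange := by
    rintro _ ⟨e, he, rfl⟩ _ ⟨e', he', rfl⟩
    exact ⟨assocCoordChange ρ e e', contMDiffOn_assocCoordChange ρ he he',
      fun x hx v => assocCoordChange_apply ρ he he' hx v⟩

/-- `P ×_G ℝⁿ` is a smooth vector bundle. -/
instance : ContMDiffVectorBundle ∞ (Rn n) (B.AssocFibre ρ) (𝓡 n) :=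
  (B.assocPrebundle ρ).contMDiffVectorBundle (𝓡 n)

/-- The total space of `P ×_G ℝⁿ`. -/
abbrev Assoc : Type max v u := TotalSpace (Rn n) (B.AssocFibre ρ)

/-- The quotient map `P × ℝⁿ → P ×_G ℝⁿ`, `(p, v) ↦ [p, v]`. -/
def assocMk (p : B.Total) (v : Rn n) : B.Assoc ρ := ⟨B.proj p, cls ρ ⟨p, rfl⟩ v⟩

/-! ### The three kinds of data -/

/-- A smooth equivariant bundle map `P → GL(M)` over the identity of `M`. -/
structure FrameMap where
  toFun : B.Total → FrameBundle n B.Base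
  contMDiff : ContMDiff I_P (frameModel n) ∞ toFun
  proj_toFun : ∀ p, (toFun p).proj = B.proj p
  equivariant : ∀ (p : B.Total) (g : G), toFun (op g • p) = op (ρ g : GLRn n) • toFun p

/-- A soldering form: a smooth `ℝⁿ`-valued `1`-form `α` on `P` which is horizontal, equivariant
(`R_g^* α = g⁻¹ · α`) and onto `ℝⁿ` at each point. -/
structure SolderingForm where
  form : ContMDiffSection I_P (E_P →L[ℝ] Rn n) ∞
    (fun p : B.Total => TangentSpace I_P p →L[ℝ] Bundle.Trivial B.Total (Rn n) p)
  horizontal : ∀ (p : B.Total) (X : TangentSpace I_P p),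
    mfderiv I_P (𝓡 n) B.proj p X = 0 → form p X = 0
  equivariant : ∀ (p : B.Total) (g : G) (X : TangentSpace I_P p),
    form (op g • p) (mfderiv I_P I_P (fun q : B.Total => op g • q) p X) = linAct ρ g⁻¹ (form p X)
  onto : ∀ p : B.Total, Function.Surjective (form p)

/-- A smooth vector bundle isomorphism `TM ≃ P ×_G ℝⁿ` over the identity of `M`. -/
structure TangentIso where
  toFun : ∀ x : B.Base, TangentSpace (𝓡 n) x ≃ₗ[ℝ] B.AssocFibre ρ x
  contMDiff : ContMDiff ((𝓡 n).prod 𝓘(ℝ, Rn n)) ((𝓡 n).prod 𝓘(ℝ, Rn n)) ∞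
    (fun w : TangentBundle (𝓡 n) B.Base => (⟨w.1, toFun w.1 w.2⟩ : B.Assoc ρ))
  contMDiff_symm : ContMDiff ((𝓡 n).prod 𝓘(ℝ, Rn n)) ((𝓡 n).prod 𝓘(ℝ, Rn n)) ∞
    (fun z : B.Assoc ρ => (⟨z.1, (toFun z.1).symm z.2⟩ : TangentBundle (𝓡 n) B.Base))

variable {B ρ} in
/-- The map of total spaces `TM → P ×_G ℝⁿ`. -/
def TangentIso.total (ψ : B.TangentIso ρ) (w : TangentBundle (𝓡 n) B.Base) : B.Assoc ρ :=
  ⟨w.1, ψ.toFun w.1 w.2⟩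

/-! ### Morphisms and pull-back of the data -/

/-- A morphism of principal `G`-bundles `P' → P` over a local diffeomorphism `M' → M`. -/
structure Hom (B' B : PrincipalBundle.{u, v} I_G I_P G n) where
  toFun : B'.Total → B.Total
  base : B'.Base → B.Base
  contMDiff : ContMDiff I_P I_P ∞ toFun
  isLocalDiffeomorph : IsLocalDiffeomorph (𝓡 n) (𝓡 n) ∞ base
  proj_toFun : ∀ p, B.proj (toFun p) = base (B'.proj p)
  equivariant : ∀ (p : B'.Total) (g : G), toFun (op g • p) = op g • toFun p

namespace Hom

variable {B' B : PrincipalBundle.{u, v} I_G I_P G n} (f : Hom B' B) {ρ}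

/-- `Φ'` is the pull-back of `Φ` along `f`: the frame `Φ'(p)` is mapped by the differential of the
base map to the frame `Φ(f(p))`. -/
def PullsBackFrame (Φ : B.FrameMap ρ) (Φ' : B'.FrameMap ρ) : Prop :=
  ∀ (p : B'.Total) (v : Rn n),
    tangentMap (𝓡 n) (𝓡 n) f.base ((Φ'.toFun p).apply v) = (Φ.toFun (f.toFun p)).apply v

/-- `α'` is the pull-back `f^* α`. -/
def PullsBackForm (α : B.SolderingForm ρ) (α' : B'.SolderingForm ρ) : Prop :=
  ∀ (p : B'.Total) (X : TangentSpace I_P p),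
    α'.form p X = α.form (f.toFun p) (mfderiv I_P I_P f.toFun p X)

/-- `ψ'` is the pull-back of `ψ` along `f`: the isomorphisms are intertwined by the differential of
the base map and by the map `[p, v] ↦ [f(p), v]` of associated bundles. -/
def PullsBackIso (ψ : B.TangentIso ρ) (ψ' : B'.TangentIso ρ) : Prop :=
  ∀ (w : TangentBundle (𝓡 n) B'.Base) (p : B'.Total) (v : Rn n),
    ψ'.total w = B'.assocMk ρ p v →
      ψ.total (tangentMap (𝓡 n) (𝓡 n) f.base w) = B.assocMk ρ (f.toFun p) v

end Hom

end PrincipalBundle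

end

/-! ### Smooth families of linear maps -/

section LinearFamilies

variable {E H N F F' : Type*} [NormedAddCommGroup E] [NormedSpace ℝ E] [TopologicalSpace H]
  {I : ModelWithCorners ℝ E H} [TopologicalSpace N] [ChartedSpace H N]
  [NormedAddCommGroup F] [NormedSpace ℝ F] [NormedAddCommGroup F'] [NormedSpace ℝ F']

/-! All three kinds of data encode, for each p over x, an identification of ℝⁿ with T_xM that
changes by ρ(g) when p moves to p·g. A frame map gives α_p = Φ(p)⁻¹ ∘ dπ_p. Conversely,
horizontality lets α_p factor through the surjection dπ_p (`surjective_mfderiv_proj`), and the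
factor, being onto between spaces of equal finite dimension, inverts to a frame
(`exists_equiv_comp_eq`). Since v ↦ [p, v] is an isomorphism onto the fibre of P ×_G ℝⁿ, the formula
ψ(Φ(p)v) = [p, v] can be solved for either ψ or Φ; equivariance makes ψ independent of p
(`assocMk_coord_eq`). The relations Φ(p)(α_p X) = dπ X and ψ(Φ(p)v) = [p, v] determine each datum
from the other, because the maps involved are injective or onto. The inverse laws and naturality
follow by cancelling these maps.

The analytic content is smoothness. A map to GL(M) can be tested on fixed vectors
(`FrameBundle.contMDiffAt_of_forall_apply`), and coordinates in a smooth frame are smooth because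
operator inversion is (`FrameBundle.contMDiffAt_coord`). Passing from α to Φ uses a smooth local
right inverse of α (`exists_contMDiffAt_rightInverse`); passing between Φ and ψ uses smooth local
sections of P. -/

theorem contMDiffAt_clm_of_forall_apply [FiniteDimensional ℝ F] {k : WithTop ℕ∞}
    {f : N → F →L[ℝ] F'} {x₀ : N}
    (hf : ∀ v, ContMDiffAt I 𝓘(ℝ, F') k (fun x => f x v) x₀) :
    ContMDiffAt I 𝓘(ℝ, F →L[ℝ] F') k f x₀ := by
  let b := Module.finBasis ℝ F
  -- In a basis b, f is a finite sum of fixed continuous linear maps applied to the functions x ↦ f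
  -- x (b i).
  have h : f = fun x => ∑ i, ContinuousLinearMap.smulRightL ℝ F F'
      (LinearMap.toContinuousLinearMap (b.coord i)) (f x (b i)) := by
    funext x
    ext v
    conv_lhs => rw [← b.sum_repr v]
    simp only [map_sum, map_smul, sum_apply]
    rfl
  rw [h]
  exact ContMDiffAt.sum fun i _ =>
    (ContinuousLinearMap.contMDiff _).contMDiffAt.comp x₀ (hf (b i))

/-- Fix a right inverse r₁ of f x₀. Then f x ∘ r₁ is the identity at x₀, hence invertible nearby,
and r₁ ∘ (f x ∘ r₁)⁻¹ is a right inverse there; inversion is smooth at invertible operators. -/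
theorem exists_contMDiffAt_rightInverse [FiniteDimensional ℝ F'] {k : WithTop ℕ∞}
    {f : N → F →L[ℝ] F'} {x₀ : N} (hf : ContMDiffAt I 𝓘(ℝ, F →L[ℝ] F') k f x₀)
    (hs : Function.Surjective (f x₀)) :
    ∃ r : N → F' →L[ℝ] F, ContMDiffAt I 𝓘(ℝ, F' →L[ℝ] F) k r x₀ ∧
      ∀ᶠ x in 𝓝 x₀, ∀ v, f x (r x v) = v := by
  obtain ⟨r₀, hr₀⟩ := (f x₀ : F →ₗ[ℝ] F').exists_rightInverse_of_surjective
    (LinearMap.range_eq_top.2 hs)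
  let r₁ : F' →L[ℝ] F := LinearMap.toContinuousLinearMap r₀
  have : CompleteSpace F' := FiniteDimensional.complete ℝ F'
  have h₀ : f x₀ ∘L r₁ = ContinuousLinearMap.id ℝ F' := by
    ext v; exact LinearMap.congr_fun hr₀ v
  have hc : ContMDiffAt I 𝓘(ℝ, F' →L[ℝ] F') k (fun x => f x ∘L r₁) x₀ :=
    hf.clm_comp contMDiffAt_const
  have hi : (f x₀ ∘L r₁).IsInvertible := by
    rw [h₀]; exact ⟨ContinuousLinearEquiv.refl ℝ F', rfl⟩
  refine ⟨fun x => r₁ ∘L ContinuousLinearMap.inverse (f x ∘L r₁), ?_, ?_⟩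
  · exact contMDiffAt_const.clm_comp
      ((hi.contDiffAt_map_inverse.contMDiffAt).comp x₀ hc)
  · have ho : IsOpen (range ((↑) : (F' ≃L[ℝ] F') → F' →L[ℝ] F')) := ContinuousLinearEquiv.isOpen
    filter_upwards [hc.continuousAt.preimage_mem_nhds (ho.mem_nhds hi)] with x hx v
    exact ContinuousLinearMap.IsInvertible.self_apply_inverse (f := f x ∘L r₁) hx v

end LinearFamilies

/-! ### Smooth maps to the frame bundle -/

namespace FrameBundle

variable {n : ℕ} {M : Type u} [TopologicalSpace M] [ChartedSpace (Rn n) M]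
  [IsManifold (𝓡 n) ∞ M]

theorem isInvertible (u : FrameBundle n M) : u.1.2.IsInvertible := u.2

/-- The coordinates of a tangent vector in the frame `u`. -/
noncomputable def coord (u : FrameBundle n M) (w : TangentBundle (𝓡 n) M) : Rn n :=
  (ContinuousLinearMap.inverse u.1.2 : Rn n →L[ℝ] Rn n) w.2

theorem coord_apply (u : FrameBundle n M) (v : Rn n) : u.coord (u.apply v) = v :=
  u.isInvertible.inverse_apply_self v

theorem apply_coord (u : FrameBundle n M) {w : TangentBundle (𝓡 n) M} (hw : w.1 = u.proj) :
    u.apply (u.coord w) = w := by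
  obtain ⟨x, w⟩ := w
  obtain rfl : x = u.1.1 := hw
  exact congrArg (TotalSpace.mk u.1.1) (u.isInvertible.self_apply_inverse w)

theorem apply_injective (u : FrameBundle n M) : Function.Injective u.apply :=
  Function.LeftInverse.injective u.coord_apply

theorem ext_apply {u u' : FrameBundle n M} (h : ∀ v, u.apply v = u'.apply v) : u = u' := by
  obtain ⟨⟨x, a⟩, ha⟩ := u
  obtain ⟨⟨x', a'⟩, ha'⟩ := u'
  -- The image of any vector, for instance 0, remembers the base point of the frame.
  obtain rfl : x = x' := congrArg TotalSpace.proj (h 0)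
  have : a = a' := by
    ext1 v
    exact eq_of_heq (TotalSpace.mk.inj (h v)).2
  subst this
  rfl

variable {E H N : Type*} [NormedAddCommGroup E] [NormedSpace ℝ E] [TopologicalSpace H]
  {I : ModelWithCorners ℝ E H} [TopologicalSpace N] [ChartedSpace H N]
  {f : N → FrameBundle n M} {x₀ : N}

/-- The frame `u` read in the trivialization of the tangent bundle at `x`. -/
noncomputable def inCoord (x : M) (u : FrameBundle n M) : EndRn n :=
  ContinuousLinearMap.inCoordinates (Rn n) (Bundle.Trivial M (Rn n)) (Rn n)
    (TangentSpace (𝓡 n) : M → Type _) x u.1.1 x u.1.1 u.1.2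

theorem inCoord_eq {x : M} {u : FrameBundle n M}
    (hu : u.proj ∈ (trivializationAt (Rn n) (TangentSpace (𝓡 n) : M → Type _) x).baseSet) :
    ∃ a : Rn n ≃L[ℝ] Rn n, inCoord x u = a ∧ ∀ v, a v =
      (trivializationAt (Rn n) (TangentSpace (𝓡 n) : M → Type _) x (u.apply v)).2 := by
  obtain ⟨⟨y, l⟩, hl⟩ := u
  obtain ⟨a, rfl⟩ : l.IsInvertible := hl
  refine ⟨(((trivializationAt (Rn n) (Bundle.Trivial M (Rn n)) x).continuousLinearEquivAt
    ℝ y (mem_univ _)).symm.trans a).trans ((trivializationAt (Rn n) (TangentSpace (𝓡 n) :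
      M → Type _) x).continuousLinearEquivAt ℝ y hu),
    ContinuousLinearMap.inCoordinates_eq (mem_univ _) hu, fun v => ?_⟩
  -- The source ℝⁿ is a trivial bundle, whose trivialization contributes only the identity.
  have h : ((trivializationAt (Rn n) (Bundle.Trivial M (Rn n)) x).continuousLinearEquivAt
    ℝ y (mem_univ _)).symm v = v := (ContinuousLinearEquiv.symm_apply_eq _).2 rfl
  simp only [ContinuousLinearEquiv.trans_apply]
  rw [h]
  rfl

theorem inCoord_apply {x : M} {u : FrameBundle n M}
    (hu : u.proj ∈ (trivializationAt (Rn n) (TangentSpace (𝓡 n) : M → Type _) x).baseSet)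
    (v : Rn n) :
    inCoord x u v =
      (trivializationAt (Rn n) (TangentSpace (𝓡 n) : M → Type _) x (u.apply v)).2 := by
  obtain ⟨a, ha, hv⟩ := inCoord_eq hu
  rw [ha, ← hv]
  rfl

theorem isInvertible_inCoord {x : M} {u : FrameBundle n M}
    (hu : u.proj ∈ (trivializationAt (Rn n) (TangentSpace (𝓡 n) : M → Type _) x).baseSet) :
    (inCoord x u).IsInvertible := by
  obtain ⟨a, ha, -⟩ := inCoord_eq hu
  exact ⟨a, ha.symm⟩

/-- GL(M) is open in the total space of Hom(ℝⁿ, TM), where smoothness is read off from the base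
point and the matrix in coordinates. -/
theorem contMDiffAt_iff_inCoord : ContMDiffAt I (frameModel n) ∞ f x₀ ↔
    ContMDiffAt I (𝓡 n) ∞ (fun x => (f x).proj) x₀ ∧
      ContMDiffAt I 𝓘(ℝ, EndRn n) ∞ (fun x => inCoord (f x₀).proj (f x)) x₀ :=
  (ContMDiffAt.subtypeVal_comp_iff
    (⟨{u | u.2.IsInvertible}, isOpen_isInvertible_frameHom n M⟩ :
      TopologicalSpace.Opens (FrameHomTotal n M)) f x₀).symm.trans (contMDiffAt_hom_bundle _)

theorem contMDiff_proj : ContMDiff (frameModel n) (𝓡 n) ∞ (proj : FrameBundle n M → M) :=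
  fun _ => (contMDiffAt_iff_inCoord.1 contMDiffAt_id).1

theorem eventually_mem_baseSet (hf : ContMDiffAt I (𝓡 n) ∞ (fun x => (f x).proj) x₀) :
    ∀ᶠ x in 𝓝 x₀, (f x).proj ∈
      (trivializationAt (Rn n) (TangentSpace (𝓡 n) : M → Type _) (f x₀).proj).baseSet :=
  hf.continuousAt.preimage_mem_nhds
    ((trivializationAt _ _ _).open_baseSet.mem_nhds (mem_baseSet_trivializationAt _ _ _))

theorem contMDiffAt_of_forall_apply
    (h : ∀ v, ContMDiffAt I ((𝓡 n).prod 𝓘(ℝ, Rn n)) ∞ (fun x => (f x).apply v) x₀) :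
    ContMDiffAt I (frameModel n) ∞ f x₀ := by
  have hp := (contMDiffAt_totalSpace.1 (h 0)).1
  refine contMDiffAt_iff_inCoord.2 ⟨hp, contMDiffAt_clm_of_forall_apply fun v => ?_⟩
  refine (contMDiffAt_totalSpace.1 (h v)).2.congr_of_eventuallyEq ?_
  filter_upwards [eventually_mem_baseSet hp] with x hx
  exact inCoord_apply hx v

theorem contMDiffAt_apply (hf : ContMDiffAt I (frameModel n) ∞ f x₀) {v : N → Rn n}
    (hv : ContMDiffAt I 𝓘(ℝ, Rn n) ∞ v x₀) :
    ContMDiffAt I ((𝓡 n).prod 𝓘(ℝ, Rn n)) ∞ (fun x => (f x).apply (v x)) x₀ := by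
  obtain ⟨hp, hc⟩ := contMDiffAt_iff_inCoord.1 hf
  refine contMDiffAt_totalSpace.2 ⟨hp, (hc.clm_apply hv).congr_of_eventuallyEq ?_⟩
  filter_upwards [eventually_mem_baseSet hp] with x hx
  exact (inCoord_apply hx (v x)).symm

/-- In a trivialization of TM, this is the inverse of the matrix of the frame applied to the
coordinates of w. The base points must agree near x₀ for this formula to hold there. -/
theorem contMDiffAt_coord (hf : ContMDiffAt I (frameModel n) ∞ f x₀)
    {w : N → TangentBundle (𝓡 n) M} (hw : ContMDiffAt I ((𝓡 n).prod 𝓘(ℝ, Rn n)) ∞ w x₀)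
    (hfw : ∀ᶠ x in 𝓝 x₀, (w x).1 = (f x).proj) :
    ContMDiffAt I 𝓘(ℝ, Rn n) ∞ (fun x => (f x).coord (w x)) x₀ := by
  obtain ⟨hp, hc⟩ := contMDiffAt_iff_inCoord.1 hf
  have hi : (inCoord (f x₀).proj (f x₀)).IsInvertible :=
    isInvertible_inCoord (mem_baseSet_trivializationAt _ _ _)
  have hinv := (hi.contDiffAt_map_inverse (n := ∞)).contMDiffAt.comp x₀ hc
  refine (hinv.clm_apply (contMDiffAt_totalSpace.1 hw).2).congr_of_eventuallyEq ?_
  filter_upwards [eventually_mem_baseSet hp, hfw] with x hx hwx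
  have h₀ : (w x₀).1 = (f x₀).proj := hfw.self_of_nhds
  rw [h₀]
  conv_rhs => rw [← (f x).apply_coord hwx, ← inCoord_apply hx]
  exact ((isInvertible_inCoord hx).inverse_apply_self _).symm

end FrameBundle

/-! ### Smooth one-forms -/

section OneForms

variable {E H N F : Type*} [NormedAddCommGroup E] [NormedSpace ℝ E] [TopologicalSpace H]
  {I : ModelWithCorners ℝ E H} [TopologicalSpace N] [ChartedSpace H N] [IsManifold I ∞ N]
  [NormedAddCommGroup F] [NormedSpace ℝ F]

/-- A linear form on the tangent space at `q`, read in the trivialization at `p`. -/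
noncomputable def formInCoord (p q : N) (a : TangentSpace I q →L[ℝ] F) : E →L[ℝ] F :=
  ContinuousLinearMap.inCoordinates E (TangentSpace I : N → Type _) F (Bundle.Trivial N F)
    p q p q a

theorem formInCoord_apply {p q : N} (a : TangentSpace I q →L[ℝ] F)
    (hq : q ∈ (trivializationAt E (TangentSpace I : N → Type _) p).baseSet) (v : E) :
    formInCoord p q a v = a ((trivializationAt E (TangentSpace I : N → Type _) p).symm q v) := by
  unfold formInCoord
  rw [ContinuousLinearMap.inCoordinates_eq hq (mem_univ _)]
  rfl

/-- The trivialization at p reads this local vector field as v itself. Such fields serve both to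
test forms and to lift vectors through them. -/
theorem contMDiffAt_symm_tangent {p : N} {v : N → E} (hv : ContMDiffAt I 𝓘(ℝ, E) ∞ v p) :
    ContMDiffAt I (I.prod 𝓘(ℝ, E)) ∞ (fun q => (⟨q, (trivializationAt E
      (TangentSpace I : N → Type _) p).symm q (v q)⟩ : TangentBundle I N)) p := by
  have hp := mem_baseSet_trivializationAt E (TangentSpace I : N → Type _) p
  refine contMDiffAt_totalSpace.2 ⟨contMDiffAt_id, hv.congr_of_eventuallyEq ?_⟩
  filter_upwards [(trivializationAt E (TangentSpace I : N → Type _) p).open_baseSet.mem_nhds hp]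
    with q hq
  exact congrArg Prod.snd (Trivialization.apply_mk_symm _ hq (v q))

theorem contMDiffAt_formInCoord {α : ∀ p : N, TangentSpace I p →L[ℝ] Bundle.Trivial N F p} {p : N}
    (h : ContMDiffAt I (I.prod 𝓘(ℝ, E →L[ℝ] F)) ∞ (fun p => TotalSpace.mk' (E →L[ℝ] F)
      (E := fun p : N => TangentSpace I p →L[ℝ] Bundle.Trivial N F p) p (α p)) p) :
    ContMDiffAt I 𝓘(ℝ, E →L[ℝ] F) ∞ (fun q => formInCoord p q (α q)) p :=
  ((contMDiffAt_hom_bundle _).1 h).2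

/-- The coordinates of α evaluated on a fixed v are α evaluated on the local vector field with
constant coordinates v. -/
theorem contMDiff_form_of_apply [FiniteDimensional ℝ E]
    {α : ∀ p : N, TangentSpace I p →L[ℝ] Bundle.Trivial N F p}
    (h : ContMDiff (I.prod 𝓘(ℝ, E)) 𝓘(ℝ, F) ∞ (fun X : TangentBundle I N => (α X.1 X.2 : F))) :
    ContMDiff I (I.prod 𝓘(ℝ, E →L[ℝ] F)) ∞ (fun p => TotalSpace.mk' (E →L[ℝ] F)
      (E := fun p : N => TangentSpace I p →L[ℝ] Bundle.Trivial N F p) p (α p)) := by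
  intro p
  refine (contMDiffAt_hom_bundle _).2 ⟨contMDiffAt_id, contMDiffAt_clm_of_forall_apply fun v => ?_⟩
  refine ((h _).comp p (contMDiffAt_symm_tangent
    (contMDiffAt_const (c := v)))).congr_of_eventuallyEq ?_
  filter_upwards [(trivializationAt E (TangentSpace I : N → Type _) p).open_baseSet.mem_nhds
    (mem_baseSet_trivializationAt _ _ _)] with q hq
  exact formInCoord_apply (α q) hq v

end OneForms

/-- With r a right inverse of D, the map A = a ∘ r satisfies A ∘ D = a, since X - r (D X) lies in
ker D and so in ker a. As a is onto, A is an onto endomorphism of ℝⁿ, hence bijective, and l is its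
inverse. -/
theorem exists_equiv_comp_eq {V : Type*} [NormedAddCommGroup V] [NormedSpace ℝ V] {n : ℕ}
    {D a : V →L[ℝ] Rn n} (hD : Function.Surjective D) (ha : Function.Surjective a)
    (h : ∀ X, D X = 0 → a X = 0) : ∃ l : Rn n ≃L[ℝ] Rn n, ∀ X, l (a X) = D X := by
  obtain ⟨r, hr⟩ := (D : V →ₗ[ℝ] Rn n).exists_rightInverse_of_surjective
    (LinearMap.range_eq_top.2 hD)
  have hr' : ∀ w, D (r w) = w := fun w => LinearMap.congr_fun hr w
  let A : Rn n →ₗ[ℝ] Rn n := (a : V →ₗ[ℝ] Rn n) ∘ₗ r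
  have hA : ∀ X, A (D X) = a X := fun X => by
    have h1 := h (X - r (D X)) (by rw [map_sub, hr', sub_self])
    rw [map_sub, sub_eq_zero] at h1
    exact h1.symm
  have hs : Function.Surjective A := fun v => by
    obtain ⟨X, rfl⟩ := ha v
    exact ⟨_, hA X⟩
  refine ⟨(LinearEquiv.ofBijective A
    ⟨LinearMap.injective_iff_surjective.2 hs, hs⟩).symm.toContinuousLinearEquiv, fun X => ?_⟩
  change (LinearEquiv.ofBijective A _).symm (a X) = D X
  rw [LinearEquiv.symm_apply_eq]
  exact (hA X).symm

namespace PrincipalBundle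

variable {E_G H_G E_P H_P : Type*}
  [NormedAddCommGroup E_G] [NormedSpace ℝ E_G] [TopologicalSpace H_G]
  [NormedAddCommGroup E_P] [NormedSpace ℝ E_P] [TopologicalSpace H_P]
  {I_G : ModelWithCorners ℝ E_G H_G} {I_P : ModelWithCorners ℝ E_P H_P}
  {G : Type*} [TopologicalSpace G] [ChartedSpace H_G G] [Group G] {n : ℕ}
  {B : PrincipalBundle.{u, v} I_G I_P G n}
  {ρ : ContMDiffMonoidMorphism I_G 𝓘(ℝ, EndRn n) ∞ G (GLRn n)}

/-! ### Differentials of the projection and of the action -/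

theorem contMDiffAt_symm_trivialization {e : Trivialization G B.proj}
    (he : IsPrincipalTrivialization I_G I_P n e) {x : B.Base} (hx : x ∈ e.baseSet) (g : G) :
    ContMDiffAt (𝓡 n) I_P ∞ (fun y => e.toOpenPartialHomeomorph.symm (y, g)) x := by
  have h : ContMDiffAt ((𝓡 n).prod I_G) I_P ∞ e.toOpenPartialHomeomorph.symm (x, g) :=
    he.contMDiffOn_symm.contMDiffAt (e.open_target.mem_nhds (e.mem_target.2 hx))
  exact h.comp x (contMDiffAt_id.prodMk contMDiffAt_const)

theorem surjective_mfderiv_proj (p : B.Total) :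
    Function.Surjective (mfderiv I_P (𝓡 n) B.proj p) := by
  have hx := mem_trivAt (B.proj p)
  have he := trivAt_spec (B.proj p)
  set e := trivAt (B.proj p)
  have hp : p ∈ e.source := e.mem_source.2 hx
  -- The constant group coordinate is that of p, so that this local section passes through p;
  -- differentiating π ∘ s = id there gives a right inverse of dπ_p.
  let s : B.Base → B.Total := fun y => e.toOpenPartialHomeomorph.symm (y, (e p).2)
  have hsp : s (B.proj p) = p := e.symm_apply_mk_proj hp
  have hs : MDifferentiableAt (𝓡 n) I_P s (B.proj p) :=
    (contMDiffAt_symm_trivialization he hx _).mdifferentiableAt (by simp)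
  have hπ : MDifferentiableAt I_P (𝓡 n) B.proj (s (B.proj p)) :=
    (B.contMDiff_proj _).mdifferentiableAt (by simp)
  have h1 : HasMFDerivAt (𝓡 n) (𝓡 n) (B.proj ∘ s) (B.proj p)
      (ContinuousLinearMap.id ℝ (TangentSpace (𝓡 n) (B.proj p))) := by
    refine (hasMFDerivAt_id _).congr_of_eventuallyEq ?_
    filter_upwards [e.open_baseSet.mem_nhds hx] with y hy
    exact e.proj_symm_apply' hy
  have h2 := h1.mfderiv.symm.trans (mfderiv_comp (B.proj p) hπ hs)
  intro w
  have h3 := congrArg (fun l : Rn n →L[ℝ] Rn n => l w) h2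
  rw [hsp] at h3
  exact ⟨_, h3.symm⟩

theorem exists_tangentMap_proj (p : B.Total) {w : TangentBundle (𝓡 n) B.Base}
    (hw : w.1 = B.proj p) :
    ∃ X : TangentSpace I_P p, tangentMap I_P (𝓡 n) B.proj ⟨p, X⟩ = w := by
  obtain ⟨x, w⟩ := w
  obtain rfl : x = B.proj p := hw
  obtain ⟨X, rfl⟩ := surjective_mfderiv_proj p w
  exact ⟨X, rfl⟩

theorem contMDiff_smul (g : G) : ContMDiff I_P I_P ∞ (fun q : B.Total => op g • q) :=
  B.contMDiff_action.comp (contMDiff_id.prodMk contMDiff_const)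

theorem tangentMap_proj_smul (p : B.Total) (g : G) (X : TangentSpace I_P p) :
    tangentMap I_P (𝓡 n) B.proj
      ⟨op g • p, mfderiv I_P I_P (fun q : B.Total => op g • q) p X⟩ =
    tangentMap I_P (𝓡 n) B.proj ⟨p, X⟩ := by
  have h := tangentMap_comp_at (I := I_P) (I' := I_P) (I'' := 𝓡 n)
    (f := fun q : B.Total => op g • q) (g := B.proj)
    (⟨p, X⟩ : TangentBundle I_P B.Total) ((B.contMDiff_proj _).mdifferentiableAt (by simp))
    ((contMDiff_smul g p).mdifferentiableAt (by simp))
  have h2 : B.proj ∘ (fun q : B.Total => op g • q) = B.proj := funext fun q => B.proj_smul q g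
  rw [h2] at h
  exact h.symm

/-! ### The quotient map to the associated bundle -/

variable (B ρ) in
/-- The linear isomorphism `v ↦ [p, v]`. -/
noncomputable def clsLinear {x : B.Base} (p : B.Fibre x) :
    Rn n ≃ₗ[ℝ] B.AssocFibre ρ x :=
  LinearEquiv.ofBijective
    { toFun := cls ρ p, map_add' := cls_add ρ p, map_smul' := cls_smul ρ p } (cls_bijective ρ p)

theorem assocMk_eq {x : B.Base} (p : B.Fibre x) (v : Rn n) :
    B.assocMk ρ p.1 v = ⟨x, cls ρ p v⟩ := by
  obtain ⟨p, rfl⟩ := p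
  rfl

theorem assocMk_injective (p : B.Total) : Function.Injective (B.assocMk ρ p) := fun _ _ h =>
  (cls_bijective ρ ⟨p, rfl⟩).1 (eq_of_heq (TotalSpace.mk.inj h).2)

theorem assocMk_smul (p : B.Total) (g : G) (v : Rn n) :
    B.assocMk ρ (op g • p) v = B.assocMk ρ p (linAct ρ g v) := by
  refine (assocMk_eq (ρ := ρ) (x := B.proj p) ⟨op g • p, B.proj_smul p g⟩ v).trans ?_
  exact congrArg (TotalSpace.mk (B.proj p)) ((cls_eq_cls ρ).2 ⟨g, rfl, by simp⟩).symm

theorem trivializationAt_assoc_apply {x y : B.Base} (hy : y ∈ (trivAt x).baseSet)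
    (z : B.AssocFibre ρ y) :
    trivializationAt (Rn n) (B.AssocFibre ρ) x ⟨y, z⟩ = (y, trivCoord ρ (trivAt_spec x) hy z) :=
  assocPretriv_apply ρ (trivAt_spec x) hy z

/-- A local trivialization e of P turns the quotient map into (q, v) ↦ ρ((e q).2) v on the fibre
coordinate. -/
theorem contMDiff_assocMk : ContMDiff (I_P.prod 𝓘(ℝ, Rn n)) ((𝓡 n).prod 𝓘(ℝ, Rn n)) ∞
    (fun y : B.Total × Rn n => B.assocMk ρ y.1 y.2) := by
  rintro ⟨p, v⟩
  have hp : ContMDiff (I_P.prod 𝓘(ℝ, Rn n)) (𝓡 n) ∞ (fun y : B.Total × Rn n => B.proj y.1) :=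
    B.contMDiff_proj.comp contMDiff_fst
  have hx := mem_trivAt (B.proj p)
  have he := trivAt_spec (B.proj p)
  refine contMDiffAt_totalSpace.2 ⟨hp.contMDiffAt, ?_⟩
  have h1 : ContMDiffAt I_P ((𝓡 n).prod I_G) ∞ (trivAt (B.proj p)) p :=
    he.contMDiffOn.contMDiffAt ((trivAt (B.proj p)).open_source.mem_nhds
      ((trivAt (B.proj p)).mem_source.2 hx))
  have h2 : ContMDiffAt I_P 𝓘(ℝ, EndRn n) ∞
      (fun q => linAct ρ ((trivAt (B.proj p)) q).2) p :=
    ((contMDiff_linAct ρ).comp contMDiff_snd).contMDiffAt.comp p h1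
  refine ((h2.comp (p, v) contMDiffAt_fst).clm_apply contMDiffAt_snd).congr_of_eventuallyEq ?_
  filter_upwards [hp.continuous.continuousAt.preimage_mem_nhds
    ((trivAt (B.proj p)).open_baseSet.mem_nhds hx)] with y hy
  exact congrArg Prod.snd (trivializationAt_assoc_apply hy _)

end PrincipalBundle

namespace PrincipalBundle

variable {E_G H_G E_P H_P : Type*}
  [NormedAddCommGroup E_G] [NormedSpace ℝ E_G] [TopologicalSpace H_G]
  [NormedAddCommGroup E_P] [NormedSpace ℝ E_P] [TopologicalSpace H_P]
  {I_G : ModelWithCorners ℝ E_G H_G} {I_P : ModelWithCorners ℝ E_P H_P}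
  {G : Type*} [TopologicalSpace G] [ChartedSpace H_G G] [Group G] {n : ℕ}
  {B : PrincipalBundle.{u, v} I_G I_P G n}
  {ρ : ContMDiffMonoidMorphism I_G 𝓘(ℝ, EndRn n) ∞ G (GLRn n)}

/-! ### Bundle maps to the frame bundle and soldering forms -/

theorem FrameMap.ext_apply {Φ Φ' : B.FrameMap ρ}
    (h : ∀ p v, (Φ.toFun p).apply v = (Φ'.toFun p).apply v) : Φ = Φ' := by
  obtain ⟨f, _, _, _⟩ := Φ
  obtain ⟨f', _, _, _⟩ := Φ'
  obtain rfl : f = f' := funext fun p => FrameBundle.ext_apply (h p)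
  rfl

theorem SolderingForm.ext_apply {α α' : B.SolderingForm ρ}
    (h : ∀ (p : B.Total) (X : TangentSpace I_P p), α.form p X = α'.form p X) : α = α' := by
  obtain ⟨f, _, _, _⟩ := α
  obtain ⟨f', _, _, _⟩ := α'
  obtain rfl : f = f' := ContMDiffSection.ext fun p => ContinuousLinearMap.ext (h p)
  rfl

namespace FrameMap

variable (Φ : B.FrameMap ρ)

theorem apply_smul (p : B.Total) (g : G) (v : Rn n) :
    (Φ.toFun (op g • p)).apply v = (Φ.toFun p).apply (linAct ρ g v) := by
  rw [Φ.equivariant, FrameBundle.apply_smul]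
  rfl

theorem apply_coord {p : B.Total} {w : TangentBundle (𝓡 n) B.Base} (hw : w.1 = B.proj p) :
    (Φ.toFun p).apply ((Φ.toFun p).coord w) = w :=
  FrameBundle.apply_coord _ (hw.trans (Φ.proj_toFun p).symm)

/-- The values of the soldering form of `Φ`. -/
noncomputable def formVal (p : B.Total) :
    TangentSpace I_P p →L[ℝ] Bundle.Trivial B.Total (Rn n) p :=
  (ContinuousLinearMap.inverse (Φ.toFun p).1.2 : Rn n →L[ℝ] Rn n) ∘L
    (mfderiv I_P (𝓡 n) B.proj p : E_P →L[ℝ] Rn n)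

theorem formVal_apply (p : B.Total) (X : TangentSpace I_P p) :
    Φ.formVal p X = (Φ.toFun p).coord (tangentMap I_P (𝓡 n) B.proj ⟨p, X⟩) := rfl

theorem apply_formVal (p : B.Total) (X : TangentSpace I_P p) :
    (Φ.toFun p).apply (Φ.formVal p X) = tangentMap I_P (𝓡 n) B.proj ⟨p, X⟩ :=
  Φ.apply_coord (w := tangentMap I_P (𝓡 n) B.proj ⟨p, X⟩) rfl

/-- The soldering form of a bundle map to the frame bundle. -/
noncomputable def solderingForm [FiniteDimensional ℝ E_P] : B.SolderingForm ρ where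
  form := ⟨Φ.formVal, contMDiff_form_of_apply fun X =>
    FrameBundle.contMDiffAt_coord
      (Φ.contMDiff.contMDiffAt.comp X (Bundle.contMDiff_proj (TangentSpace I_P)).contMDiffAt)
      (B.contMDiff_proj.contMDiff_tangentMap (by simp)).contMDiffAt
      (.of_forall fun X => (Φ.proj_toFun X.1).symm)⟩
  horizontal p X h := by
    change (ContinuousLinearMap.inverse (Φ.toFun p).1.2 : Rn n →L[ℝ] Rn n)
      (mfderiv I_P (𝓡 n) B.proj p X) = 0
    rw [h]
    exact map_zero (ContinuousLinearMap.inverse (Φ.toFun p).1.2 : Rn n →L[ℝ] Rn n)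
  equivariant p g X := by
    -- After applying the frame at p·g, both sides become dπ X, because translation by g preserves
    -- π.
    apply (Φ.toFun (op g • p)).apply_injective
    refine (Φ.apply_formVal _ _).trans ?_
    rw [tangentMap_proj_smul, Φ.apply_smul, linAct_inv_apply]
    exact (Φ.apply_formVal p X).symm
  onto p v := by
    obtain ⟨X, hX⟩ := exists_tangentMap_proj p (w := (Φ.toFun p).apply v) (Φ.proj_toFun p)
    refine ⟨X, ?_⟩
    change Φ.formVal p X = v
    rw [formVal_apply, hX, FrameBundle.coord_apply]

theorem apply_solderingForm [FiniteDimensional ℝ E_P] (p : B.Total) (X : TangentSpace I_P p) :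
    (Φ.toFun p).apply (Φ.solderingForm.form p X) = tangentMap I_P (𝓡 n) B.proj ⟨p, X⟩ :=
  Φ.apply_formVal p X

/-- This is the chain rule for the projection of GL(M) composed with Φ, which is π. -/
theorem solderingForm_eq_pullback [FiniteDimensional ℝ E_P] (p : B.Total)
    (X : TangentSpace I_P p) : Φ.solderingForm.form p X =
      (Φ.toFun p).solderingForm (mfderiv I_P (frameModel n) Φ.toFun p X) := by
  have h := tangentMap_comp_at (I := I_P) (I' := frameModel n) (I'' := 𝓡 n) (f := Φ.toFun)
    (g := FrameBundle.proj) (⟨p, X⟩ : TangentBundle I_P B.Total)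
    ((FrameBundle.contMDiff_proj _).mdifferentiableAt (by simp))
    ((Φ.contMDiff p).mdifferentiableAt (by simp))
  have h2 : FrameBundle.proj ∘ Φ.toFun = B.proj := funext Φ.proj_toFun
  rw [h2] at h
  exact congrArg (Φ.toFun p).coord h

end FrameMap

namespace SolderingForm

variable (α : B.SolderingForm ρ)

theorem exists_equiv (p : B.Total) : ∃ l : Rn n ≃L[ℝ] Rn n,
    ∀ X : TangentSpace I_P p, l (α.form p X) = mfderiv I_P (𝓡 n) B.proj p X :=
  exists_equiv_comp_eq (V := E_P) (D := (mfderiv I_P (𝓡 n) B.proj p : E_P →L[ℝ] Rn n))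
    (a := (α.form p : E_P →L[ℝ] Rn n)) (surjective_mfderiv_proj p) (α.onto p) (α.horizontal p)

/-- The frame at `p` through which the differential of the projection factors. -/
noncomputable def frameAt (p : B.Total) : FrameBundle n B.Base :=
  ⟨⟨B.proj p, ((Classical.choose (α.exists_equiv p) : Rn n ≃L[ℝ] Rn n) : Rn n →L[ℝ] Rn n)⟩,
    ⟨(Classical.choose (α.exists_equiv p) : Rn n ≃L[ℝ] Rn n), rfl⟩⟩

theorem frameAt_apply_form (p : B.Total) (X : TangentSpace I_P p) :
    (α.frameAt p).apply (α.form p X) = tangentMap I_P (𝓡 n) B.proj ⟨p, X⟩ :=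
  congrArg (TotalSpace.mk (B.proj p)) (Classical.choose_spec (α.exists_equiv p) X)

/-- The pointwise choice of frame is harmless: if r is a smooth local right inverse of α, the frame
at q must send v = α(r_q v) to dπ(r_q v), which is smooth in q. -/
theorem contMDiff_frameAt : ContMDiff I_P (frameModel n) ∞ α.frameAt := by
  refine fun p => FrameBundle.contMDiffAt_of_forall_apply fun v => ?_
  have hp := mem_baseSet_trivializationAt E_P (TangentSpace I_P : B.Total → Type _) p
  have hs : Function.Surjective (formInCoord p p (α.form p)) := fun w => by
    obtain ⟨X, rfl⟩ := α.onto p w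
    refine ⟨(trivializationAt E_P (TangentSpace I_P : B.Total → Type _) p ⟨p, X⟩).2, ?_⟩
    rw [formInCoord_apply _ hp]
    exact congrArg (α.form p) (Trivialization.symm_apply_apply_mk _ hp X)
  obtain ⟨r, hr, hr'⟩ := exists_contMDiffAt_rightInverse
    (contMDiffAt_formInCoord (α.form.contMDiff p)) hs
  have hX := contMDiffAt_symm_tangent (hr.clm_apply (contMDiffAt_const (c := v)))
  refine (((B.contMDiff_proj.contMDiff_tangentMap (m := ∞) (by simp)).contMDiffAt.comp p
    hX)).congr_of_eventuallyEq ?_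
  filter_upwards [hr', (trivializationAt E_P (TangentSpace I_P : B.Total → Type _)
    p).open_baseSet.mem_nhds hp] with q hq hq'
  have h := hq v
  rw [formInCoord_apply _ hq'] at h
  refine Eq.trans ?_ (α.frameAt_apply_form q _)
  exact congrArg (α.frameAt q).apply h.symm

/-- The bundle map to the frame bundle given by a soldering form. -/
noncomputable def frameMap : B.FrameMap ρ where
  toFun := α.frameAt
  contMDiff := α.contMDiff_frameAt
  proj_toFun _ := rfl
  equivariant p g := by
    refine FrameBundle.ext_apply fun v => ?_
    -- Writing ρ(g)v as α_p(X) makes v the value of α at p·g on the translate of X, so both frames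
    -- can be compared through dπ X.
    obtain ⟨X, hX⟩ := α.onto p (linAct ρ g v)
    have hv : v = α.form (op g • p) (mfderiv I_P I_P (fun q : B.Total => op g • q) p X) := by
      rw [α.equivariant, hX, linAct_apply_inv]
    rw [FrameBundle.apply_smul]
    conv_lhs => rw [hv]
    refine (α.frameAt_apply_form _ _).trans ?_
    rw [tangentMap_proj_smul, ← α.frameAt_apply_form, hX]
    rfl

theorem frameMap_apply_form (p : B.Total) (X : TangentSpace I_P p) :
    (α.frameMap.toFun p).apply (α.form p X) = tangentMap I_P (𝓡 n) B.proj ⟨p, X⟩ :=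
  α.frameAt_apply_form p X

end SolderingForm

variable (B ρ) in
/-- Equivariant bundle maps to the frame bundle correspond to soldering forms. -/
noncomputable def frameMapEquiv [FiniteDimensional ℝ E_P] : B.FrameMap ρ ≃ B.SolderingForm ρ where
  toFun Φ := Φ.solderingForm
  invFun α := α.frameMap
  left_inv Φ := FrameMap.ext_apply fun p v => by
    -- Every v is a value of the form at X, and both frames send that value to dπ X.
    obtain ⟨X, rfl⟩ := Φ.solderingForm.onto p v
    exact (SolderingForm.frameMap_apply_form _ p X).trans (Φ.apply_solderingForm p X).symm
  right_inv α := SolderingForm.ext_apply fun p X => (α.frameMap.toFun p).apply_injective <|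
    (FrameMap.apply_solderingForm _ p X).trans (α.frameMap_apply_form p X).symm

/-! ### Bundle maps to the frame bundle and isomorphisms with the associated bundle -/

namespace FrameMap

variable (Φ : B.FrameMap ρ)

/-- Replacing p by p·g multiplies the coordinates by ρ(g)⁻¹, exactly the change absorbed by the
relation defining P ×_G ℝⁿ. -/
theorem assocMk_coord_eq {p q : B.Total} (h : B.proj q = B.proj p)
    {w : TangentBundle (𝓡 n) B.Base} (hw : w.1 = B.proj p) :
    B.assocMk ρ q ((Φ.toFun q).coord w) = B.assocMk ρ p ((Φ.toFun p).coord w) := by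
  obtain ⟨g, rfl⟩ := transitive h
  rw [assocMk_smul]
  congr 1
  apply (Φ.toFun p).apply_injective
  rw [← Φ.apply_smul, Φ.apply_coord hw, Φ.apply_coord (hw.trans h.symm)]

/-- The coordinates, in the frame over an auxiliary point, of the tangent vectors at `x`. -/
noncomputable def ptFrameCoord (x : B.Base) : TangentSpace (𝓡 n) x →ₗ[ℝ] Rn n :=
  ((ContinuousLinearMap.inverse (Φ.toFun (pt x).1).1.2 : Rn n →L[ℝ] Rn n) : Rn n →ₗ[ℝ] Rn n)

theorem bijective_ptFrameCoord (x : B.Base) : Function.Bijective (Φ.ptFrameCoord x) :=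
  ((Φ.toFun (pt x).1).isInvertible.inverse).bijective

/-- The fibrewise isomorphism from the tangent bundle to the associated bundle. -/
noncomputable def isoAt (x : B.Base) : TangentSpace (𝓡 n) x ≃ₗ[ℝ] B.AssocFibre ρ x :=
  (LinearEquiv.ofBijective (Φ.ptFrameCoord x) (Φ.bijective_ptFrameCoord x)).trans
    (B.clsLinear ρ (pt x))

/-- The auxiliary point need not vary continuously with x; this allows it to be replaced by a smooth
local section in the smoothness proofs. -/
theorem isoAt_eq {p : B.Total} {w : TangentBundle (𝓡 n) B.Base} (hw : w.1 = B.proj p) :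
    (⟨w.1, Φ.isoAt w.1 w.2⟩ : B.Assoc ρ) = B.assocMk ρ p ((Φ.toFun p).coord w) := by
  rw [← Φ.assocMk_coord_eq ((pt w.1).2.trans hw) hw]
  exact (assocMk_eq (ρ := ρ) (pt w.1) _).symm

theorem isoAt_apply (p : B.Total) (v : Rn n) :
    (⟨((Φ.toFun p).apply v).1, Φ.isoAt _ ((Φ.toFun p).apply v).2⟩ : B.Assoc ρ) =
      B.assocMk ρ p v := by
  rw [Φ.isoAt_eq (Φ.proj_toFun p), FrameBundle.coord_apply]

theorem isoAt_symm_assocMk (p : B.Total) (v : Rn n) :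
    (⟨(B.assocMk ρ p v).1, (Φ.isoAt _).symm (B.assocMk ρ p v).2⟩ : TangentBundle (𝓡 n) B.Base) =
      (Φ.toFun p).apply v := by
  rw [← Φ.isoAt_apply p v]
  exact congrArg (TotalSpace.mk _) (LinearEquiv.symm_apply_apply _ _)

theorem contMDiff_isoAt : ContMDiff ((𝓡 n).prod 𝓘(ℝ, Rn n)) ((𝓡 n).prod 𝓘(ℝ, Rn n)) ∞
    (fun w : TangentBundle (𝓡 n) B.Base => (⟨w.1, Φ.isoAt w.1 w.2⟩ : B.Assoc ρ)) := by
  intro w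
  have hx := mem_trivAt w.1
  have hs := (contMDiffAt_symm_trivialization (trivAt_spec w.1) hx 1).comp w
    (Bundle.contMDiff_proj (TangentSpace (𝓡 n) : B.Base → Type _)).contMDiffAt
  have hev : ∀ᶠ w' : TangentBundle (𝓡 n) B.Base in 𝓝 w,
      w'.1 = B.proj ((trivAt w.1).toOpenPartialHomeomorph.symm (w'.1, 1)) := by
    filter_upwards [(FiberBundle.continuous_proj (Rn n) (TangentSpace (𝓡 n) : B.Base → Type _)
      ).continuousAt.preimage_mem_nhds ((trivAt w.1).open_baseSet.mem_nhds hx)] with w' hw'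
    exact ((trivAt w.1).proj_symm_apply' hw').symm
  have hc := FrameBundle.contMDiffAt_coord (Φ.contMDiff.contMDiffAt.comp w hs) contMDiffAt_id
    (hev.mono fun w' h => h.trans (Φ.proj_toFun _).symm)
  refine (contMDiff_assocMk.contMDiffAt.comp w (hs.prodMk hc)).congr_of_eventuallyEq ?_
  filter_upwards [hev] with w' hw'
  exact Φ.isoAt_eq hw'

theorem contMDiff_isoAt_symm : ContMDiff ((𝓡 n).prod 𝓘(ℝ, Rn n)) ((𝓡 n).prod 𝓘(ℝ, Rn n)) ∞
    (fun z : B.Assoc ρ => (⟨z.1, (Φ.isoAt z.1).symm z.2⟩ : TangentBundle (𝓡 n) B.Base)) := by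
  intro z
  have hx := mem_trivAt z.1
  have hs := (contMDiffAt_symm_trivialization (trivAt_spec z.1) hx 1).comp z
    (Bundle.contMDiff_proj (B.AssocFibre ρ)).contMDiffAt
  have hc : ContMDiffAt ((𝓡 n).prod 𝓘(ℝ, Rn n)) 𝓘(ℝ, Rn n) ∞ (fun z' : B.Assoc ρ =>
      (trivializationAt (Rn n) (B.AssocFibre ρ) z.1 z').2) z :=
    (contMDiffAt_totalSpace.1 contMDiffAt_id).2
  refine (FrameBundle.contMDiffAt_apply (Φ.contMDiff.contMDiffAt.comp z hs)
    hc).congr_of_eventuallyEq ?_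
  filter_upwards [(FiberBundle.continuous_proj (Rn n) (B.AssocFibre ρ)
    ).continuousAt.preimage_mem_nhds ((trivAt z.1).open_baseSet.mem_nhds hx)] with z' hz'
  refine Eq.trans ?_ (Φ.isoAt_symm_assocMk _ _)
  -- Along the section with group coordinate 1, the fibre coordinate of z' is the vector
  -- representing it, so the inverse isomorphism is the frame along that section applied to this
  -- coordinate.
  have h : z' = B.assocMk ρ ((trivAt z.1).toOpenPartialHomeomorph.symm (z'.1, 1))
      (trivializationAt (Rn n) (B.AssocFibre ρ) z.1 z').2 := by
    refine Eq.trans ?_ (assocMk_eq (ρ := ρ) (sect (trivAt z.1) hz') _).symm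
    obtain ⟨y, z'⟩ := z'
    rw [trivializationAt_assoc_apply hz', cls_sect_trivCoord]
  exact congrArg (fun z : B.Assoc ρ =>
    (⟨z.1, (Φ.isoAt z.1).symm z.2⟩ : TangentBundle (𝓡 n) B.Base)) h

/-- The isomorphism from the tangent bundle to the associated bundle given by `Φ`. -/
noncomputable def tangentIso : B.TangentIso ρ :=
  ⟨Φ.isoAt, Φ.contMDiff_isoAt, Φ.contMDiff_isoAt_symm⟩

theorem tangentIso_total_apply (p : B.Total) (v : Rn n) :
    Φ.tangentIso.total ((Φ.toFun p).apply v) = B.assocMk ρ p v := Φ.isoAt_apply p v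

end FrameMap

/-! ### Recovering the frame map from an isomorphism with the associated bundle. -/

namespace TangentIso

variable (ψ : B.TangentIso ρ)

theorem ext_total {ψ ψ' : B.TangentIso ρ} (h : ∀ w, ψ.total w = ψ'.total w) : ψ = ψ' := by
  obtain ⟨f, _, _⟩ := ψ
  obtain ⟨f', _, _⟩ := ψ'
  obtain rfl : f = f' := funext fun x => LinearEquiv.ext fun w =>
    eq_of_heq (TotalSpace.mk.inj (h ⟨x, w⟩)).2
  rfl

theorem total_injective : Function.Injective ψ.total := by
  rintro ⟨x, w⟩ ⟨x', w'⟩ h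
  obtain rfl : x = x' := congrArg TotalSpace.proj h
  exact congrArg (TotalSpace.mk x) ((ψ.toFun x).injective (eq_of_heq (TotalSpace.mk.inj h).2))

/-- The frame `v ↦ ψ⁻¹ [p, v]`. -/
noncomputable def frameAt (p : B.Total) : FrameBundle n B.Base :=
  let l : Rn n ≃ₗ[ℝ] Rn n := (B.clsLinear ρ ⟨p, rfl⟩).trans (ψ.toFun (B.proj p)).symm
  ⟨⟨B.proj p, (l.toContinuousLinearEquiv : Rn n →L[ℝ] Rn n)⟩, ⟨l.toContinuousLinearEquiv, rfl⟩⟩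

theorem total_frameAt_apply (p : B.Total) (v : Rn n) :
    ψ.total ((ψ.frameAt p).apply v) = B.assocMk ρ p v :=
  congrArg (TotalSpace.mk (B.proj p)) ((ψ.toFun (B.proj p)).apply_symm_apply _)

/-- The bundle map to the frame bundle given by an isomorphism with the associated bundle. -/
noncomputable def frameMap : B.FrameMap ρ where
  toFun := ψ.frameAt
  -- For fixed v the frame sends v to ψ⁻¹[p, v], a composite of smooth maps in p.
  contMDiff _ := FrameBundle.contMDiffAt_of_forall_apply fun _ =>
    (ψ.contMDiff_symm.comp (contMDiff_assocMk.comp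
      (contMDiff_id.prodMk contMDiff_const))).contMDiffAt
  proj_toFun _ := rfl
  equivariant p g := FrameBundle.ext_apply fun v => ψ.total_injective <| by
    rw [total_frameAt_apply, FrameBundle.apply_smul, total_frameAt_apply, assocMk_smul]
    rfl

theorem total_frameMap_apply (p : B.Total) (v : Rn n) :
    ψ.total ((ψ.frameMap.toFun p).apply v) = B.assocMk ρ p v := ψ.total_frameAt_apply p v

end TangentIso

variable (B ρ) in
/-- Equivariant bundle maps to the frame bundle correspond to isomorphisms of the tangent bundle
with the associated bundle. -/
noncomputable def tangentIsoEquiv : B.FrameMap ρ ≃ B.TangentIso ρ where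
  toFun Φ := Φ.tangentIso
  invFun ψ := ψ.frameMap
  left_inv Φ := FrameMap.ext_apply fun p v => Φ.tangentIso.total_injective <|
    (TangentIso.total_frameMap_apply _ p v).trans (Φ.tangentIso_total_apply p v).symm
  right_inv ψ := TangentIso.ext_total fun w => by
    -- Any tangent vector is the image of its own coordinates under a frame over its base point,
    -- where both isomorphisms are known.
    rw [← ψ.frameMap.apply_coord (p := (pt w.1).1) (pt w.1).2.symm,
      FrameMap.tangentIso_total_apply, TangentIso.total_frameMap_apply]

theorem total_tangentMap_proj {α : B.SolderingForm ρ} (p : B.Total) (X : TangentSpace I_P p) :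
    α.frameMap.tangentIso.total (tangentMap I_P (𝓡 n) B.proj ⟨p, X⟩) =
      B.assocMk ρ p (α.form p X) := by
  rw [← α.frameMap_apply_form, FrameMap.tangentIso_total_apply]

/-! ### Naturality -/

namespace Hom

variable {B' : PrincipalBundle.{u, v} I_G I_P G n} (f : Hom B' B)

/-- The two sides are the two chain-rule expansions of π ∘ f = φ ∘ π'. Both naturality statements
reduce to this identity. -/
theorem tangentMap_base_tangentMap_proj (p : B'.Total) (X : TangentSpace I_P p) :
    tangentMap (𝓡 n) (𝓡 n) f.base (tangentMap I_P (𝓡 n) B'.proj ⟨p, X⟩) =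
      tangentMap I_P (𝓡 n) B.proj ⟨f.toFun p, mfderiv I_P I_P f.toFun p X⟩ := by
  have h1 := tangentMap_comp_at (I := I_P) (I' := 𝓡 n) (I'' := 𝓡 n) (f := B'.proj)
    (g := f.base) (⟨p, X⟩ : TangentBundle I_P B'.Total)
    ((f.isLocalDiffeomorph.contMDiff _).mdifferentiableAt (by simp))
    ((B'.contMDiff_proj p).mdifferentiableAt (by simp))
  have h2 := tangentMap_comp_at (I := I_P) (I' := I_P) (I'' := 𝓡 n) (f := f.toFun)
    (g := B.proj) (⟨p, X⟩ : TangentBundle I_P B'.Total)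
    ((B.contMDiff_proj _).mdifferentiableAt (by simp))
    ((f.contMDiff p).mdifferentiableAt (by simp))
  have h3 : B.proj ∘ f.toFun = f.base ∘ B'.proj := funext f.proj_toFun
  rw [h3] at h2
  exact h1.symm.trans h2

theorem pullsBackFrame_iff_pullsBackForm [FiniteDimensional ℝ E_P] (Φ : B.FrameMap ρ)
    (Φ' : B'.FrameMap ρ) :
    f.PullsBackFrame Φ Φ' ↔ f.PullsBackForm Φ.solderingForm Φ'.solderingForm := by
  constructor
  · intro h p X
    apply (Φ.toFun (f.toFun p)).apply_injective
    rw [← h, Φ'.apply_solderingForm, tangentMap_base_tangentMap_proj, Φ.apply_solderingForm]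
  · intro h p v
    obtain ⟨X, rfl⟩ := Φ'.solderingForm.onto p v
    rw [Φ'.apply_solderingForm, tangentMap_base_tangentMap_proj, h, Φ.apply_solderingForm]

theorem pullsBackForm_iff_pullsBackIso (α : B.SolderingForm ρ) (α' : B'.SolderingForm ρ) :
    f.PullsBackForm α α' ↔ f.PullsBackIso α.frameMap.tangentIso α'.frameMap.tangentIso := by
  constructor
  · intro h w p v hw
    -- The hypothesis places w over π'(p), so w = dπ'(X) for some X; injectivity of [p, ·] then
    -- forces v = α'(X).
    obtain ⟨X, rfl⟩ := exists_tangentMap_proj p (congrArg TotalSpace.proj hw)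
    rw [total_tangentMap_proj] at hw
    rw [tangentMap_base_tangentMap_proj, total_tangentMap_proj, ← h, assocMk_injective p hw]
  · intro h p X
    have h1 := h _ p _ (total_tangentMap_proj p X)
    rw [tangentMap_base_tangentMap_proj, total_tangentMap_proj] at h1
    exact (assocMk_injective _ h1).symm

end Hom

end PrincipalBundle

/-! ### Assembling the correspondence. -/

theorem mainTheorem7 {E_G H_G E_P H_P : Type*}
    [NormedAddCommGroup E_G] [NormedSpace ℝ E_G] [FiniteDimensional ℝ E_G] [TopologicalSpace H_G]
    [NormedAddCommGroup E_P] [NormedSpace ℝ E_P] [FiniteDimensional ℝ E_P] [TopologicalSpace H_P]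
    (I_G : ModelWithCorners ℝ E_G H_G) [I_G.Boundaryless]
    (I_P : ModelWithCorners ℝ E_P H_P) [I_P.Boundaryless]
    (G : Type*) [TopologicalSpace G] [ChartedSpace H_G G] [Group G] [LieGroup I_G ∞ G] (n : ℕ)
    (ρ : ContMDiffMonoidMorphism I_G 𝓘(ℝ, EndRn n) ∞ G (GLRn n)) :
    ∃ (e₁₂ : ∀ B : PrincipalBundle.{u, v} I_G I_P G n, B.FrameMap ρ ≃ B.SolderingForm ρ)
      (e₂₃ : ∀ B : PrincipalBundle.{u, v} I_G I_P G n, B.SolderingForm ρ ≃ B.TangentIso ρ),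
      -- the form attached to `Φ : P → GL(M)` is the pull-back of the canonical soldering form
      (∀ (B : PrincipalBundle.{u, v} I_G I_P G n) (Φ : B.FrameMap ρ) (p : B.Total)
        (X : TangentSpace I_P p),
        (e₁₂ B Φ).form p X =
          (Φ.toFun p).solderingForm (mfderiv I_P (frameModel n) Φ.toFun p X)) ∧
      -- the bundle map attached to `α` is inverse to the factorization of `α` through `dπ`
      (∀ (B : PrincipalBundle.{u, v} I_G I_P G n) (α : B.SolderingForm ρ) (p : B.Total)
        (X : TangentSpace I_P p),
        (((e₁₂ B).symm α).toFun p).apply (α.form p X) = tangentMap I_P (𝓡 n) B.proj ⟨p, X⟩) ∧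
      -- the isomorphism attached to `α` maps `dπ(X)` to `[p, α(X)]`
      (∀ (B : PrincipalBundle.{u, v} I_G I_P G n) (α : B.SolderingForm ρ) (p : B.Total)
        (X : TangentSpace I_P p),
        (e₂₃ B α).total (tangentMap I_P (𝓡 n) B.proj ⟨p, X⟩) = B.assocMk ρ p (α.form p X)) ∧
      -- the isomorphism attached to `Φ` maps `Φ(p)(v)` to `[p, v]`
      (∀ (B : PrincipalBundle.{u, v} I_G I_P G n) (Φ : B.FrameMap ρ) (p : B.Total) (v : Rn n),
        (e₂₃ B (e₁₂ B Φ)).total ((Φ.toFun p).apply v) = B.assocMk ρ p v) ∧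
      -- both equivalences are compatible with pull-back along morphisms of principal bundles
      (∀ (B' B : PrincipalBundle.{u, v} I_G I_P G n) (f : PrincipalBundle.Hom B' B)
        (Φ : B.FrameMap ρ) (Φ' : B'.FrameMap ρ),
        f.PullsBackFrame Φ Φ' ↔ f.PullsBackForm (e₁₂ B Φ) (e₁₂ B' Φ')) ∧
      (∀ (B' B : PrincipalBundle.{u, v} I_G I_P G n) (f : PrincipalBundle.Hom B' B)
        (α : B.SolderingForm ρ) (α' : B'.SolderingForm ρ),
        f.PullsBackForm α α' ↔ f.PullsBackIso (e₂₃ B α) (e₂₃ B' α')) := by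
  refine ⟨fun B => B.frameMapEquiv ρ,
    -- The second bijection passes through frame maps, so its composite with the first collapses to
    -- `tangentIsoEquiv`.
    fun B => (B.frameMapEquiv ρ).symm.trans (B.tangentIsoEquiv ρ),
    fun _ Φ => Φ.solderingForm_eq_pullback, fun _ α => α.frameMap_apply_form,
    fun _ α => PrincipalBundle.total_tangentMap_proj, fun B Φ p v => ?_,
    fun _ _ f => f.pullsBackFrame_iff_pullsBackForm,
    fun _ _ f => f.pullsBackForm_iff_pullsBackIso⟩
  rw [Equiv.trans_apply, Equiv.symm_apply_apply]
  exact Φ.tangentIso_total_apply p v
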